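/- **Proposition (Approximation of the reciprocal function by attention-only Transformers).** *Definitions.* For $\lambda>0$ let $\mathrm{Softmax}_\lambda$ be the column-wise softmax, $\mathrm{Softmax}_\lambda(S)_{ik}=e^{\lambda S_{ik}}/\sum_j e^{\lambda S_{jk}}$. An $H$-head attention layer with inverse temperature $\lambda$ is a map $$\mathrm{Attn}(Z)=\sum_{h=1}^H W_V^{(h)}Z\,\mathrm{Softmax}_\lambda\big((W_K^{(h)}Z)^\top W_Q^{(h)}Z\big),\qquad W_K^{(h)},W_Q^{(h)}\in\mathbb R^{d_h\times d_{\rm in}},\ W_V^{(h)}\in\mathbb R^{d_{\rm out}\times d_{\rm in}},$$ and $W_{KQ}^{(h)}:=(W_K^{(h)})^\top W_Q^{(h)}$. For input sequences $X\in\mathbb R^{d\times n}$ (columns are tokens) let the preprocessing layer be $$P(X)=\begin{bmatrix}X&0\\ I_n&0\\ 0&1\end{bmatrix}\in\mathbb R^{(d+n+1)\times(n+1)},$$ and let $T$ delete the last token (column). Write $\mathcal T(H,W,K,C_{KQ},C_V)$ for the class of maps $T\circ\mathrm{Attn}^{(K)}\circ\cdots\circ\mathrm{Attn}^{(1)}\circ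 P$ in which every layer has $H\ge1$ heads, $K\ge 1$, all token dimensions and head dimensions are at most $W$, $\|W_{KQ}\|_F\le C_{KQ}$ and $\|W_V\|_F\le C_V$ for every head of every layer, and all layers use the same $\lambda>0$. Here $d=n=1$ and the output is a scalar. *Statement.* There are a constant $C>0$ and real polynomials $p,q$ such that for every $\epsilon\in(0,1)$ and every $C_X>0$, with $\delta:=1/\epsilon$, there exist $H,W,K,C_{KQ},C_V,\lambda$ and $f_{\rm inv}\in\mathcal T(H,W,K,C_{KQ},C_V)$ with inverse temperature $\lambda$ such that $$\Big|f_{\rm inv}(x')-\frac1x\Big|\le 2\epsilon+\frac{|x'-x|}{\epsilon^2}\qquad\text{for all }x\in[\epsilon,1/\epsilon],\ x'\in[-C_X,C_X],$$ and, whenever $C_X\ge1$, $$H\le C(1+\ln\delta)^3,\quad W\le C(1+\ln\delta)^3,\quad K\le C(1+\ln\delta)^2,\quad C_V\le C\,\delta^2\sqrt{(1+\ln\delta)^3},$$ $$C_{KQ}\le C\sqrt{(1+\ln\delta)^2\,(1+\ln(\delta C_X))},\qquad \lambda\le C\,\delta^{p(\ln\delta)}\,(1+\ln\delta)^{q(\ln\delta)}\,(1+\ln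 C_X).$$ -/

import Mathlib

namespace SoftmaxAttention

/-- Column-wise softmax with inverse temperature `lam`:
the `(i, k)` entry is `exp (lam * S i k) / ∑ j, exp (lam * S j k)`. -/
noncomputable def softmax (lam : ℝ) {m n : ℕ} (S : Matrix (Fin m) (Fin n) ℝ) :
    Matrix (Fin m) (Fin n) ℝ :=
  Matrix.of fun i k => Real.exp (lam * S i k) / ∑ j, Real.exp (lam * S j k)

/-- The Frobenius norm of a real matrix. -/
noncomputable def frobNorm {m n : ℕ} (A : Matrix (Fin m) (Fin n) ℝ) : ℝ :=
  letI : NormedAddCommGroup (Matrix (Fin m) (Fin n) ℝ) := Matrix.frobeniusNormedAddCommGroup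
  ‖A‖

theorem frobNorm_eq_sqrt {m n : ℕ} (A : Matrix (Fin m) (Fin n) ℝ) :
    frobNorm A = Real.sqrt (∑ i, ∑ j, A i j ^ 2) := by
  simp [frobNorm, Matrix.frobenius_norm_def, Real.sqrt_eq_rpow]

/-- The weights of an `H`-head self-attention layer from token dimension `din` to token
dimension `dout`; head `h` has key/query dimension `headDim h`. -/
structure AttnLayer (H din dout : ℕ) where
  headDim : Fin H → ℕ
  WK : (h : Fin H) → Matrix (Fin (headDim h)) (Fin din) ℝ
  WQ : (h : Fin H) → Matrix (Fin (headDim h)) (Fin din) ℝ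
  WV : Fin H → Matrix (Fin dout) (Fin din) ℝ

/-- `W_KQ = W_Kᵀ W_Q` of head `h`. -/
def AttnLayer.WKQ {H din dout : ℕ} (L : AttnLayer H din dout) (h : Fin H) :
    Matrix (Fin din) (Fin din) ℝ :=
  (L.WK h).transpose * L.WQ h

/-- The map `Z ↦ ∑ h, W_V Z softmax_lam ((W_K Z)ᵀ (W_Q Z))` on sequences of `n` tokens
(the tokens are the columns). -/
noncomputable def AttnLayer.eval {H din dout : ℕ} (L : AttnLayer H din dout) (lam : ℝ) {n : ℕ}
    (Z : Matrix (Fin din) (Fin n) ℝ) : Matrix (Fin dout) (Fin n) ℝ :=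
  ∑ h, L.WV h * Z * softmax lam ((L.WK h * Z).transpose * (L.WQ h * Z))

/-- All dimensions of the layer are at most `W`, all `‖W_KQ‖_F` at most `CKQ`, and all
`‖W_V‖_F` at most `CV`. -/
def AttnLayer.WithinBudget {H din dout : ℕ} (L : AttnLayer H din dout) (W : ℕ) (CKQ CV : ℝ) :
    Prop :=
  din ≤ W ∧ dout ≤ W ∧
    ∀ h, L.headDim h ≤ W ∧ frobNorm (L.WKQ h) ≤ CKQ ∧ frobNorm (L.WV h) ≤ CV

/-- A stack of `K` attention layers with `H` heads each, from token dimension `din` to token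
dimension `dout`. In `cons L N` the layer `L` is applied first. -/
inductive AttnStack (H : ℕ) : ℕ → ℕ → ℕ → Type where
  | nil (d : ℕ) : AttnStack H 0 d d
  | cons {K din dmid dout : ℕ} (L : AttnLayer H din dmid) (N : AttnStack H K dmid dout) :
      AttnStack H (K + 1) din dout

/-- The composition of the layers of a stack, all with the same inverse temperature. -/
noncomputable def AttnStack.eval (lam : ℝ) {n H : ℕ} : {K din dout : ℕ} → AttnStack H K din dout →
    Matrix (Fin din) (Fin n) ℝ → Matrix (Fin dout) (Fin n) ℝ
  | _, _, _, .nil _, Z => Z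
  | _, _, _, .cons L N, Z => N.eval lam (L.eval lam Z)

/-- Every layer of the stack is within the budget. -/
def AttnStack.WithinBudget (W : ℕ) (CKQ CV : ℝ) {H : ℕ} :
    {K din dout : ℕ} → AttnStack H K din dout → Prop
  | _, _, _, .nil _ => True
  | _, _, _, .cons L N => L.WithinBudget W CKQ CV ∧ N.WithinBudget W CKQ CV

/-- The preprocessing layer: pad one zero token and append positional codes, that is
`X ↦ [X, 0; I_{n+1}]`. -/
def preprocess {d n : ℕ} (X : Matrix (Fin d) (Fin n) ℝ) :
    Matrix (Fin (d + (n + 1))) (Fin (n + 1)) ℝ :=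
  Matrix.of fun i j =>
    Fin.addCases (motive := fun _ => ℝ)
      (fun a : Fin d => Fin.lastCases (motive := fun _ => ℝ) 0 (fun k => X a k) j)
      (fun b : Fin (n + 1) => (1 : Matrix (Fin (n + 1)) (Fin (n + 1)) ℝ) b j) i

/-- The truncation layer: delete the last token. -/
def truncate {d n : ℕ} (Y : Matrix (Fin d) (Fin (n + 1)) ℝ) : Matrix (Fin d) (Fin n) ℝ :=
  Y.submatrix id Fin.castSucc

/-- The class of attention-only Transformers `T ∘ Attn_K ∘ ⋯ ∘ Attn_1 ∘ P` on `d × n` inputs with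
`dout × n` outputs, with `K` layers of `H` heads, width (all token and head dimensions) at most `W`,
`‖W_KQ‖_F ≤ CKQ` and `‖W_V‖_F ≤ CV` for every head of every layer, and softmax inverse
temperature `lam`. -/
def Transformer (d n dout H W K : ℕ) (CKQ CV lam : ℝ) :
    Set (Matrix (Fin d) (Fin n) ℝ → Matrix (Fin dout) (Fin n) ℝ) :=
  {f | 0 < H ∧ 0 < W ∧ 0 < K ∧ 0 < CKQ ∧ 0 < CV ∧ 0 < lam ∧
    ∃ N : AttnStack H K (d + (n + 1)) dout, N.WithinBudget W CKQ CV ∧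
      ∀ X, f X = truncate (N.eval lam (preprocess X))}

end SoftmaxAttention

/-!
For `y > 0`, the substitution `t = exp (-u)` turns `1 / y = ∫ t in Ioi 0, exp (-(y * t))` into the
integral over the whole line of a function that decays exponentially and whose Fourier transform is
a value of `Γ` on the line `Re s = 1`, hence decays exponentially as well. By Poisson summation the
truncated trapezoid rule therefore converges geometrically: `O((1 + log δ) ^ 2)` exponentials
`w * exp (-(t * y))` approximate `1 / y` up to `1 / (4 * δ)`, uniformly in `y ≥ 1 / (2 * δ)`.

On two tokens the softmax is a sigmoid of the difference of the two scores, and the sigmoid agrees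
with the exponential up to a small relative error far out in its tail. So one attention head
computes one exponential, provided that `y` is bounded below. This is ensured by a preceding layer
that replaces the input by a softmax-weighted mean of it and `ε`, which is close to the maximum of
the two. Since the resulting value matrices exceed the allowed size `O(δ ^ 2)`, part of the weight
is moved into additional layers that multiply by a constant.
-/

section GammaDecay

open Real

theorem norm_Gamma_one_add_mul_I_sq (b : ℝ) :
    ‖Complex.Gamma (1 + b * Complex.I)‖ ^ 2 * sinh (π * b) = π * b := by
  obtain rfl | hb := eq_or_ne b 0
  · simp
  have hbI : (b : ℂ) * Complex.I ≠ 0 := by simp [hb]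
  have hsinh : Complex.sinh (π * b) ≠ 0 := by
    exact_mod_cast sinh_ne_zero.2 (mul_ne_zero pi_ne_zero hb)
  have hconj : (starRingEnd ℂ) (1 + b * Complex.I) = 1 - b * Complex.I := by
    simp [sub_eq_add_neg]
  have key : (‖Complex.Gamma (1 + b * Complex.I)‖ : ℂ) ^ 2 * Complex.sinh (π * b) = π * b := by
    rw [← Complex.mul_conj', ← Complex.Gamma_conj, hconj, add_comm, Complex.Gamma_add_one _ hbI,
      mul_assoc (_ * Complex.I), Complex.Gamma_mul_Gamma_one_sub, ← mul_assoc, Complex.sin_mul_I,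
      mul_div_assoc', div_mul_eq_mul_div, div_eq_iff (mul_ne_zero hsinh Complex.I_ne_zero)]
    ring
  exact_mod_cast key

theorem mul_exp_half_le_two_mul_sinh {x : ℝ} (hx : 0 ≤ x) : x * exp (x / 2) ≤ 2 * sinh x := by
  have hsinh : x / 2 ≤ sinh (x / 2) := self_le_sinh_iff.2 (by positivity)
  have hcosh : exp (x / 2) ≤ 2 * cosh (x / 2) := by
    rw [cosh_eq]
    linarith [exp_pos (-(x / 2))]
  calc x * exp (x / 2) = 2 * ((x / 2) * exp (x / 2)) := by ring
    _ ≤ 2 * (sinh (x / 2) * (2 * cosh (x / 2))) := by gcongr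
    _ = 2 * sinh (2 * (x / 2)) := by rw [sinh_two_mul]; ring
    _ = 2 * sinh x := by ring_nf

theorem norm_Gamma_one_add_mul_I_le (b : ℝ) :
    ‖Complex.Gamma (1 + b * Complex.I)‖ ≤ 2 * exp (-(π * |b| / 4)) := by
  obtain rfl | hb := eq_or_ne b 0
  · simp
  have hx : 0 < π * |b| := by positivity
  have hsq : ‖Complex.Gamma (1 + b * Complex.I)‖ ^ 2 * sinh (π * |b|) = π * |b| := by
    have h := norm_Gamma_one_add_mul_I_sq b
    rcases abs_choice b with hb' | hb' <;> rw [hb']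
    · exact h
    · rw [mul_neg, sinh_neg, mul_neg, h]
  have hexp : exp (-(π * |b| / 4)) ^ 2 * exp (π * |b| / 2) = 1 := by
    rw [← exp_nat_mul, ← exp_add]
    push_cast
    ring_nf
    simp
  refine le_of_sq_le_sq (le_of_mul_le_mul_right ?_ (sinh_pos_iff.2 hx)) (by positivity)
  calc ‖Complex.Gamma (1 + b * Complex.I)‖ ^ 2 * sinh (π * |b|)
      = exp (-(π * |b| / 4)) ^ 2 * (π * |b| * exp (π * |b| / 2)) := by
        rw [hsq, mul_left_comm, hexp, mul_one]
    _ ≤ exp (-(π * |b| / 4)) ^ 2 * (2 * sinh (π * |b|)) := by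
        gcongr _ * ?_
        exact mul_exp_half_le_two_mul_sinh hx.le
    _ ≤ (2 * exp (-(π * |b| / 4))) ^ 2 * sinh (π * |b|) := by
        have := mul_pos (pow_pos (exp_pos (-(π * |b| / 4))) 2) (sinh_pos_iff.2 hx)
        linarith

end GammaDecay

section Trapezoid

open Real
open scoped FourierTransform

theorem sum_Icc_neg_eq_sum_range {E : Type*} [AddCommMonoid E] (f : ℤ → E) (N : ℕ) :
    ∑ n ∈ Finset.Icc (-N : ℤ) N, f n = ∑ i ∈ Finset.range (2 * N + 1), f (i - N) :=
  Finset.sum_nbij' (fun n => (n + N).toNat) (fun i => (i : ℤ) - N) (by grind) (by grind)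
    (by grind) (by grind) (by grind)

theorem sum_Icc_neg_eq_sum_range_add_sum_range_neg_sub {E : Type*} [AddCommGroup E]
    (f : ℤ → E) (N : ℕ) :
    ∑ n ∈ Finset.Icc (-N : ℤ) N, f n
      = ∑ n ∈ Finset.range (N + 1), f n + ∑ n ∈ Finset.range (N + 1), f (-n) - f 0 := by
  induction N with
  | zero => simp
  | succ N ih =>
    rw [Nat.cast_add, Nat.cast_one, Finset.Icc_succ_succ, Finset.sum_union (by simp),
      Finset.sum_pair (by lia), ih, Finset.sum_range_succ _ (N + 1),
      Finset.sum_range_succ (fun n : ℕ => f (-n)) (N + 1)]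
    push_cast
    abel

variable {E : Type*} [NormedAddCommGroup E]

theorem summable_of_norm_le_exp_neg_nat [CompleteSpace E] {f : ℕ → E} {A c : ℝ} (hc : 0 < c)
    (hf : ∀ n : ℕ, ‖f n‖ ≤ A * exp (-(c * n))) : Summable f := by
  refine .of_norm_bounded (Summable.mul_left A ?_) hf
  simpa [mul_comm] using summable_exp_nat_mul_iff.2 (neg_lt_zero.2 hc)

theorem norm_tsum_sub_sum_range_le_of_norm_le_exp_neg [CompleteSpace E] {f : ℕ → E} {A c : ℝ}
    (hc : 0 < c) (hf : ∀ n : ℕ, ‖f n‖ ≤ A * exp (-(c * n))) (N : ℕ) :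
    ‖∑' n, f n - ∑ n ∈ Finset.range (N + 1), f n‖ ≤ A * exp (-(c * N)) / (exp c - 1) := by
  have hgeom : HasSum (fun n : ℕ => A * exp (-(c * (N + 1))) * exp (-c) ^ n)
      (A * exp (-(c * (N + 1))) * (1 - exp (-c))⁻¹) :=
    (hasSum_geometric_of_lt_one (exp_pos _).le (by simpa using hc)).mul_left _
  have hvalue : A * exp (-(c * (N + 1))) * (1 - exp (-c))⁻¹ = A * exp (-(c * N)) / (exp c - 1) := by
    have : exp c - 1 ≠ 0 := (sub_pos.2 (one_lt_exp_iff.2 hc)).ne'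
    rw [mul_add, mul_one, neg_add, exp_add, exp_neg c]
    field_simp
  rw [← (summable_of_norm_le_exp_neg_nat hc hf).sum_add_tsum_nat_add (N + 1), add_sub_cancel_left,
    ← hvalue]
  refine tsum_of_norm_bounded hgeom fun n => (hf _).trans_eq ?_
  rw [mul_assoc, ← exp_nat_mul, ← exp_add]
  push_cast
  ring_nf

theorem summable_of_norm_le_exp_neg_int [CompleteSpace E] {f : ℤ → E} {A c : ℝ} (hc : 0 < c)
    (hf : ∀ n : ℤ, ‖f n‖ ≤ A * exp (-(c * |(n : ℝ)|))) : Summable f :=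
  .of_nat_of_neg (summable_of_norm_le_exp_neg_nat hc fun n => by simpa using hf n)
    (summable_of_norm_le_exp_neg_nat hc fun n => by simpa using hf (-n))

theorem norm_tsum_sub_sum_Icc_le_of_norm_le_exp_neg [CompleteSpace E] {f : ℤ → E} {A c : ℝ}
    (hc : 0 < c) (hf : ∀ n : ℤ, ‖f n‖ ≤ A * exp (-(c * |(n : ℝ)|))) (N : ℕ) :
    ‖∑' n, f n - ∑ n ∈ Finset.Icc (-N : ℤ) N, f n‖ ≤ 2 * A * exp (-(c * N)) / (exp c - 1) := by
  have hright : ∀ n : ℕ, ‖f n‖ ≤ A * exp (-(c * n)) := fun n => by simpa using hf n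
  have hleft : ∀ n : ℕ, ‖f (-n)‖ ≤ A * exp (-(c * n)) := fun n => by simpa using hf (-n)
  rw [Summable.tsum_of_nat_of_neg (summable_of_norm_le_exp_neg_nat hc hright)
    (summable_of_norm_le_exp_neg_nat hc hleft), sum_Icc_neg_eq_sum_range_add_sum_range_neg_sub,
    sub_sub_sub_cancel_right, add_sub_add_comm]
  calc _ ≤ _ := norm_add_le _ _
    _ ≤ A * exp (-(c * N)) / (exp c - 1) + A * exp (-(c * N)) / (exp c - 1) :=
      add_le_add (norm_tsum_sub_sum_range_le_of_norm_le_exp_neg hc hright N)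
        (norm_tsum_sub_sum_range_le_of_norm_le_exp_neg hc hleft N)
    _ = 2 * A * exp (-(c * N)) / (exp c - 1) := by ring

theorem fourier_comp_mul_left {F : Type*} [NormedAddCommGroup F] [NormedSpace ℂ F] (f : ℝ → F)
    {h : ℝ} (hh : 0 < h) (ξ : ℝ) :
    𝓕 (fun u => f (h * u)) ξ = h⁻¹ • 𝓕 f (ξ / h) := by
  have hsub := MeasureTheory.Measure.integral_comp_mul_left
    (fun u => fourierChar (-(u * (ξ / h))) • f u) h
  rw [abs_of_pos (inv_pos.2 hh)] at hsub
  rw [fourier_real_eq, fourier_real_eq, ← hsub]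
  congr! 5 with u
  field

theorem isBigO_cocompact_rpow_neg_two_of_norm_le_exp_neg {f : ℝ → E} {B b : ℝ} (hb : 0 < b)
    (hf : ∀ u, ‖f u‖ ≤ B * exp (-(b * |u|))) :
    f =O[Filter.cocompact ℝ] fun u => |u| ^ (-2 : ℝ) := by
  have hexp : (fun u : ℝ => exp (-b * |u|)) =O[Filter.cocompact ℝ] fun u => |u| ^ (-2 : ℝ) :=
    (isLittleO_exp_neg_mul_rpow_atTop hb (-2)).isBigO.comp_tendsto
      (tendsto_norm_cocompact_atTop (E := ℝ))
  refine .trans (.of_bound B (.of_forall fun u => ?_)) hexp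
  simpa using hf u

theorem norm_mul_tsum_sub_integral_le {f : ℝ → ℂ} (hf : Continuous f) {A a B b h : ℝ}
    (ha : 0 < a) (hb : 0 < b) (hh : 0 < h) (hdecay : ∀ u, ‖f u‖ ≤ B * exp (-(b * |u|)))
    (hfourier : ∀ ξ, ‖𝓕 f ξ‖ ≤ A * exp (-(a * |ξ|))) :
    ‖h * ∑' n : ℤ, f (h * n) - ∫ u, f u‖ ≤ 2 * A / (exp (a / h) - 1) := by
  have hsample (u : ℝ) : ‖f (h * u)‖ ≤ B * exp (-(b * h * |u|)) := by
    simpa [abs_mul, abs_of_pos hh, mul_assoc] using hdecay (h * u)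
  have hscale (ξ : ℝ) : h * 𝓕 (fun u => f (h * u)) ξ = 𝓕 f (ξ / h) := by
    rw [fourier_comp_mul_left f hh, ← Complex.real_smul, smul_inv_smul₀ hh.ne']
  have hcoeff (n : ℤ) : ‖𝓕 f (n / h)‖ ≤ A * exp (-(a / h * |(n : ℝ)|)) :=
    (hfourier _).trans_eq (by rw [abs_div, abs_of_pos hh]; ring_nf)
  have hsum : Summable fun n : ℤ => 𝓕 f (n / h) :=
    summable_of_norm_le_exp_neg_int (div_pos ha hh) hcoeff
  have hsum' : Summable fun n : ℤ => 𝓕 (fun u => f (h * u)) n := by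
    refine (summable_mul_left_iff (a := (h : ℂ)) (mod_cast hh.ne')).1 ?_
    simpa only [hscale] using hsum
  have hpoisson := tsum_eq_tsum_fourier_of_rpow_decay_of_summable (f := fun u => f (h * u))
    (by fun_prop) one_lt_two
    (isBigO_cocompact_rpow_neg_two_of_norm_le_exp_neg (mul_pos hb hh) hsample) hsum' 0
  simp only [zero_add, QuotientAddGroup.mk_zero, fourier_eval_zero, mul_one] at hpoisson
  have hzero : 𝓕 f 0 = ∫ u, f u := by
    rw [fourier_real_eq]
    simp
  rw [hpoisson, ← tsum_mul_left, ← hzero]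
  simpa [hscale] using norm_tsum_sub_sum_Icc_le_of_norm_le_exp_neg (div_pos ha hh) hcoeff 0

theorem norm_trapezoid_sub_integral_le {f : ℝ → ℂ} (hf : Continuous f) {A a B b h : ℝ}
    (ha : 0 < a) (hb : 0 < b) (hh : 0 < h) (hdecay : ∀ u, ‖f u‖ ≤ B * exp (-(b * |u|)))
    (hfourier : ∀ ξ, ‖𝓕 f ξ‖ ≤ A * exp (-(a * |ξ|))) (N : ℕ) :
    ‖h * ∑ n ∈ Finset.Icc (-N : ℤ) N, f (h * n) - ∫ u, f u‖
      ≤ 2 * A / (exp (a / h) - 1) + 2 * B / b * exp (-(b * (h * N))) := by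
  have hB : 0 ≤ B := by simpa using (norm_nonneg _).trans (hdecay 0)
  have hsample (n : ℤ) : ‖f (h * n)‖ ≤ B * exp (-(b * h * |(n : ℝ)|)) := by
    simpa [abs_mul, abs_of_pos hh, mul_assoc] using hdecay (h * n)
  have hstep : h / (exp (b * h) - 1) ≤ 1 / b := by
    rw [div_le_div_iff₀ (sub_pos.2 (one_lt_exp_iff.2 (mul_pos hb hh))) hb]
    linarith [add_one_le_exp (b * h)]
  have htail : ‖h * ∑ n ∈ Finset.Icc (-N : ℤ) N, f (h * n) - h * ∑' n : ℤ, f (h * n)‖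
      ≤ 2 * B / b * exp (-(b * (h * N))) := by
    rw [norm_sub_rev, ← mul_sub, norm_mul, Complex.norm_real, norm_of_nonneg hh.le]
    calc _ ≤ h * (2 * B * exp (-(b * h * N)) / (exp (b * h) - 1)) := by
          gcongr
          exact norm_tsum_sub_sum_Icc_le_of_norm_le_exp_neg (mul_pos hb hh) hsample N
      _ = 2 * B * (h / (exp (b * h) - 1)) * exp (-(b * (h * N))) := by rw [mul_assoc b h]; ring
      _ ≤ 2 * B * (1 / b) * exp (-(b * (h * N))) := by gcongr
      _ = 2 * B / b * exp (-(b * (h * N))) := by ring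
  calc _ ≤ _ := norm_sub_le_norm_sub_add_norm_sub _ (h * ∑' n : ℤ, f (h * n)) _
    _ ≤ _ := by
      rw [add_comm]
      exact add_le_add (norm_mul_tsum_sub_integral_le hf ha hb hh hdecay hfourier) htail

end Trapezoid

section ExpKernel

open Real
open scoped FourierTransform

/-- The integrand of `1 / y = ∫ t in Ioi 0, exp (-(y * t))` after substituting `t = exp (-u)`. -/
noncomputable def expKernel (y u : ℝ) : ℝ := exp (-u) * exp (-(y * exp (-u)))

theorem expKernel_nonneg (y u : ℝ) : 0 ≤ expKernel y u := by
  unfold expKernel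
  positivity

theorem expKernel_le_exp_neg {y : ℝ} (hy : 0 ≤ y) (u : ℝ) : expKernel y u ≤ exp (-u) := by
  refine mul_le_of_le_one_right (exp_pos _).le ?_
  rw [exp_le_one_iff, neg_nonpos]
  positivity

theorem expKernel_le_exp {y : ℝ} (hy : 0 < y) (u : ℝ) : expKernel y u ≤ 2 / y ^ 2 * exp u := by
  have hw : 0 < exp (-u) := exp_pos _
  have hquad : (y * exp (-u)) ^ 2 / 2 ≤ exp (y * exp (-u)) := by
    linarith [quadratic_le_exp_of_nonneg (mul_pos hy hw).le, mul_pos hy hw]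
  rw [expKernel, exp_neg (y * _), ← div_eq_mul_inv, div_le_iff₀ (exp_pos _)]
  calc exp (-u) = 2 / y ^ 2 * exp u * ((y * exp (-u)) ^ 2 / 2) := by
        rw [exp_neg]
        field_simp
    _ ≤ _ := by gcongr

theorem expKernel_le_exp_neg_abs {y : ℝ} (hy : 0 < y) (u : ℝ) :
    expKernel y u ≤ (1 + 2 / y ^ 2) * exp (-|u|) := by
  rw [add_mul, one_mul]
  rcases abs_choice u with hu | hu <;> rw [hu]
  · exact (expKernel_le_exp_neg hy.le u).trans (le_add_of_nonneg_right (by positivity))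
  · rw [neg_neg]
    exact (expKernel_le_exp hy u).trans (le_add_of_nonneg_left (exp_pos _).le)

theorem fourier_expKernel {y : ℝ} (hy : 0 < y) (ξ : ℝ) :
    𝓕 (fun u => (expKernel y u : ℂ)) ξ
      = (1 / y : ℂ) ^ (1 + (2 * π * ξ : ℝ) * Complex.I)
        * Complex.Gamma (1 + (2 * π * ξ : ℝ) * Complex.I) := by
  rw [← Complex.integral_cpow_mul_exp_neg_mul_Ioi (by simp) (by simpa using hy)]
  have hmellin := mellin_eq_fourier (fun t : ℝ => Complex.exp (-(y * t)))
    (s := 1 + (2 * π * ξ : ℝ) * Complex.I)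
  have him : (1 + (2 * π * ξ : ℝ) * Complex.I).im / (2 * π) = ξ := by
    simp [pi_ne_zero]
  have hre : (1 + (2 * π * ξ : ℝ) * Complex.I).re = 1 := by simp
  rw [him, hre] at hmellin
  simpa [mellin, expKernel] using hmellin.symm

theorem norm_fourier_expKernel_le {y : ℝ} (hy : 0 < y) (ξ : ℝ) :
    ‖𝓕 (fun u => (expKernel y u : ℂ)) ξ‖ ≤ 2 / y * exp (-(4 * |ξ|)) := by
  have hcpow : ‖(1 / y : ℂ) ^ (1 + (2 * π * ξ : ℝ) * Complex.I)‖ = 1 / y := by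
    rw [← Complex.ofReal_one, ← Complex.ofReal_div,
      Complex.norm_cpow_eq_rpow_re_of_pos (by positivity)]
    simp
  have hrate : 4 * |ξ| ≤ π * |2 * π * ξ| / 4 := by
    rw [abs_mul, abs_of_pos two_pi_pos]
    have hpi : 8 ≤ π * π := by nlinarith [pi_gt_three]
    linarith [mul_le_mul_of_nonneg_right hpi (abs_nonneg ξ)]
  rw [fourier_expKernel hy, norm_mul, hcpow]
  calc 1 / y * ‖Complex.Gamma (1 + (2 * π * ξ : ℝ) * Complex.I)‖
      ≤ 1 / y * (2 * exp (-(π * |2 * π * ξ| / 4))) := by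
        gcongr
        exact norm_Gamma_one_add_mul_I_le _
    _ ≤ 1 / y * (2 * exp (-(4 * |ξ|))) := by gcongr
    _ = 2 / y * exp (-(4 * |ξ|)) := by ring

theorem integral_expKernel {y : ℝ} (hy : 0 < y) : ∫ u, expKernel y u = 1 / y := by
  have hzero := fourier_expKernel hy 0
  rw [fourier_real_eq] at hzero
  simp only [mul_zero, neg_zero, AddChar.map_zero_eq_one, one_smul, Complex.ofReal_zero, zero_mul,
    add_zero, Complex.cpow_one, Complex.Gamma_one, mul_one, integral_complex_ofReal] at hzero
  exact_mod_cast hzero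

theorem abs_trapezoid_expKernel_sub_inv_le {y h : ℝ} (hy : 0 < y) (hh : 0 < h) (N : ℕ) :
    |h * ∑ n ∈ Finset.Icc (-N : ℤ) N, expKernel y (h * n) - 1 / y|
      ≤ 4 / y / (exp (4 / h) - 1) + (2 + 4 / y ^ 2) * exp (-(h * N)) := by
  have hcont : Continuous fun u => (expKernel y u : ℂ) := by
    unfold expKernel
    fun_prop
  have hdecay (u : ℝ) : ‖(expKernel y u : ℂ)‖ ≤ (1 + 2 / y ^ 2) * exp (-(1 * |u|)) := by
    rw [Complex.norm_real, norm_of_nonneg (expKernel_nonneg y u), one_mul]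
    exact expKernel_le_exp_neg_abs hy u
  have htrapezoid := norm_trapezoid_sub_integral_le hcont four_pos one_pos hh hdecay
    (norm_fourier_expKernel_le hy) N
  rw [integral_complex_ofReal, integral_expKernel hy] at htrapezoid
  norm_cast at htrapezoid
  refine htrapezoid.trans_eq ?_
  ring_nf

theorem exists_trapezoid_parameters {δ : ℝ} (hδ : 1 ≤ δ) :
    ∃ (h : ℝ) (N : ℕ), 0 < h ∧ h ≤ 1 ∧ 0 < N ∧ ((2 * N + 1 : ℕ) : ℝ) ≤ 16 * (1 + log δ) ^ 2 ∧
      exp (h * N) ≤ 1000 * δ ^ 3 ∧ 128 * δ ^ 3 ≤ exp (4 / h) ∧ 128 * δ ^ 3 ≤ exp (h * N) := by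
  have hlog : 0 ≤ log δ := log_nonneg hδ
  have hexp (k : ℕ) : exp (k + 3 * log δ) = exp 1 ^ k * δ ^ 3 := by
    rw [exp_add, exp_one_pow, ← rpow_natCast δ 3, rpow_def_of_pos (zero_lt_one.trans_le hδ)]
    push_cast
    ring_nf
  have hupper : exp (6 + 3 * log δ) ≤ 1000 * δ ^ 3 := by
    refine (hexp 6).trans_le ?_
    gcongr
    exact (pow_le_pow_left₀ (exp_pos 1).le exp_one_lt_three.le 6).trans (by norm_num)
  have hlower : 128 * δ ^ 3 ≤ exp (5 + 3 * log δ) := by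
    refine le_of_le_of_eq ?_ (hexp 5).symm
    gcongr
    exact le_trans (by norm_num) (pow_le_pow_left₀ (by norm_num) exp_one_gt_d9.le 5)
  set L := 5 + 3 * log δ with hL
  have hL0 : 0 < L := by linarith [hL]
  have hstep : 4 / L ≤ 1 := (div_le_one hL0).2 (by linarith)
  have hceil : (⌈L ^ 2 / 4⌉₊ : ℝ) ≤ L ^ 2 / 4 + 1 := (Nat.ceil_lt_add_one (by positivity)).le
  have hwindow : L ≤ 4 / L * ⌈L ^ 2 / 4⌉₊ := by
    calc L = 4 / L * (L ^ 2 / 4) := by field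
      _ ≤ _ := by gcongr; exact Nat.le_ceil _
  refine ⟨4 / L, ⌈L ^ 2 / 4⌉₊, by positivity, hstep, Nat.ceil_pos.2 (by positivity), ?_, ?_, ?_, ?_⟩
  · push_cast
    nlinarith
  · refine (exp_le_exp.2 ?_).trans hupper
    calc 4 / L * ⌈L ^ 2 / 4⌉₊ ≤ 4 / L * (L ^ 2 / 4 + 1) := by gcongr
      _ = L + 4 / L := by field
      _ ≤ 6 + 3 * log δ := by linarith
  · rwa [div_div_cancel₀ four_ne_zero]
  · exact hlower.trans (exp_le_exp.2 hwindow)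

theorem abs_trapezoid_expKernel_sub_inv_le_of_le {δ y h : ℝ} (hδ : 1 ≤ δ) (hy : 1 / (2 * δ) ≤ y)
    (hh : 0 < h) {N : ℕ} (hstep : 128 * δ ^ 3 ≤ exp (4 / h)) (hwindow : 128 * δ ^ 3 ≤ exp (h * N)) :
    |h * ∑ n ∈ Finset.Icc (-N : ℤ) N, expKernel y (h * n) - 1 / y| ≤ 1 / (4 * δ) := by
  have hy0 : 0 < y := lt_of_lt_of_le (by positivity) hy
  have hyinv : 1 / y ≤ 2 * δ := (div_le_comm₀ hy0 (by positivity)).2 hy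
  have hδ3 : 1 ≤ δ ^ 3 := one_le_pow₀ hδ
  have halias : 4 / y / (exp (4 / h) - 1) ≤ 1 / (12 * δ) := by
    rw [div_le_div_iff₀ (by linarith) (by positivity)]
    calc 4 / y * (12 * δ) = 48 * δ * (1 / y) := by ring
      _ ≤ 48 * δ * (2 * δ) := by gcongr
      _ = 96 * δ ^ 2 := by ring
      _ ≤ 1 * (exp (4 / h) - 1) := by nlinarith [mul_nonneg (sub_nonneg.2 hδ) (sq_nonneg δ)]
  have htail : (2 + 4 / y ^ 2) * exp (-(h * N)) ≤ 1 / (6 * δ) := by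
    have : 2 + 4 / y ^ 2 ≤ 18 * δ ^ 2 := by
      calc 2 + 4 / y ^ 2 = 2 * 1 + 4 * (1 / y) ^ 2 := by ring
        _ ≤ 2 * δ ^ 2 + 4 * (2 * δ) ^ 2 := by gcongr; exact one_le_pow₀ hδ
        _ = 18 * δ ^ 2 := by ring
    rw [exp_neg, ← div_eq_mul_inv, div_le_div_iff₀ (exp_pos _) (by positivity)]
    calc (2 + 4 / y ^ 2) * (6 * δ) ≤ 18 * δ ^ 2 * (6 * δ) := by gcongr
      _ = 108 * δ ^ 3 := by ring
      _ ≤ _ := by linarith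
  calc _ ≤ _ := abs_trapezoid_expKernel_sub_inv_le hy0 hh N
    _ ≤ 1 / (12 * δ) + 1 / (6 * δ) := add_le_add halias htail
    _ = 1 / (4 * δ) := by ring

theorem exists_expSum_approx_inv {δ : ℝ} (hδ : 1 ≤ δ) :
    ∃ (M : ℕ) (t w : Fin M → ℝ), 2 ≤ M ∧ (M : ℝ) ≤ 16 * (1 + log δ) ^ 2 ∧
      (∀ i, 0 ≤ t i ∧ t i ≤ 1000 * δ ^ 3) ∧ (∀ i, 0 ≤ w i ∧ w i ≤ 1000 * δ ^ 3) ∧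
      ∀ y, 1 / (2 * δ) ≤ y → |∑ i, w i * exp (-(y * t i)) - 1 / y| ≤ 1 / (4 * δ) := by
  obtain ⟨h, N, hh, hh1, hN, hM, hupper, hstep, hwindow⟩ := exists_trapezoid_parameters hδ
  have ht (i : Fin (2 * N + 1)) : exp (-(h * (i - N))) ≤ 1000 * δ ^ 3 := by
    refine (exp_le_exp.2 ?_).trans hupper
    have : 0 ≤ h * (i : ℝ) := by positivity
    linarith
  refine ⟨2 * N + 1, fun i => exp (-(h * (i - N))), fun i => h * exp (-(h * (i - N))), by lia, hM,
    fun i => ⟨(exp_pos _).le, ht i⟩, fun i => ⟨by positivity, ?_⟩, fun y hy => ?_⟩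
  · exact (mul_le_of_le_one_left (exp_pos _).le hh1).trans (ht i)
  · convert abs_trapezoid_expKernel_sub_inv_le_of_le hδ hy hh hstep hwindow using 3
    rw [sum_Icc_neg_eq_sum_range, Finset.sum_range, Finset.mul_sum]
    simp [expKernel, mul_assoc]

end ExpKernel

theorem abs_one_div_sub_one_div_le {ε x z : ℝ} (hε : 0 < ε) (hx : ε ≤ x) (hz : ε ≤ z) :
    |1 / z - 1 / x| ≤ |z - x| / ε ^ 2 := by
  have hx0 : 0 < x := hε.trans_le hx
  have hz0 : 0 < z := hε.trans_le hz
  rw [div_sub_div _ _ hz0.ne' hx0.ne', one_mul, mul_one, abs_div, abs_sub_comm,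
    abs_of_pos (mul_pos hz0 hx0), sq]
  gcongr

namespace SoftmaxAttention

open Matrix Real

theorem preprocess_one_one (x : ℝ) :
    preprocess !![x] = (!![x, 0; 1, 0; 0, 1] : Matrix (Fin 3) (Fin 2) ℝ) := by
  ext i j
  fin_cases i <;> fin_cases j <;> simp [preprocess] <;> rfl

theorem softmax_two_apply_zero (lam : ℝ) {n : ℕ} (S : Matrix (Fin 2) (Fin n) ℝ) (c : Fin n) :
    softmax lam S 0 c = sigmoid (lam * (S 0 c - S 1 c)) := by
  rw [softmax, of_apply, Fin.sum_univ_two, sigmoid_def, mul_sub, neg_sub, exp_sub]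
  field

theorem softmax_two_apply_one (lam : ℝ) {n : ℕ} (S : Matrix (Fin 2) (Fin n) ℝ) (c : Fin n) :
    softmax lam S 1 c = sigmoid (lam * (S 1 c - S 0 c)) := by
  rw [softmax, of_apply, Fin.sum_univ_two, sigmoid_def, mul_sub, neg_sub, exp_sub]
  field

/-- An attention layer whose heads have key/query dimension one, so that head `h` is given by a
key vector `k h`, a query vector `q h` and a value matrix `V h`. -/
def rankOneLayer {H din dout : ℕ} (k q : Fin H → Fin din → ℝ)
    (V : Fin H → Matrix (Fin dout) (Fin din) ℝ) : AttnLayer H din dout where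
  headDim _ := 1
  WK h := replicateRow (Fin 1) (k h)
  WQ h := replicateRow (Fin 1) (q h)
  WV := V

section RankOneLayer

variable {H din dout : ℕ} (k q : Fin H → Fin din → ℝ) (V : Fin H → Matrix (Fin dout) (Fin din) ℝ)

theorem rankOneLayer_WKQ (h : Fin H) : (rankOneLayer k q V).WKQ h = vecMulVec (k h) (q h) := by
  ext i j
  exact Fin.sum_univ_one fun _ => k h i * q h j

theorem rankOneLayer_eval (lam : ℝ) {n : ℕ} (Z : Matrix (Fin din) (Fin n) ℝ) :
    (rankOneLayer k q V).eval lam Z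
      = ∑ h, V h * Z * softmax lam (vecMulVec (k h ᵥ* Z) (q h ᵥ* Z)) := by
  refine Finset.sum_congr rfl fun h _ => congrArg (fun S => V h * Z * softmax lam S) ?_
  ext i j
  exact Fin.sum_univ_one fun _ => (k h ᵥ* Z) i * (q h ᵥ* Z) j

theorem rankOneLayer_eval_two_tokens_apply (lam : ℝ) (Z : Matrix (Fin din) (Fin 2) ℝ)
    (i : Fin dout) (c : Fin 2) :
    (rankOneLayer k q V).eval lam Z i c = ∑ h,
      ((V h * Z) i 0 * sigmoid (lam * (((k h ᵥ* Z) 0 - (k h ᵥ* Z) 1) * (q h ᵥ* Z) c))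
        + (V h * Z) i 1 * sigmoid (lam * (((k h ᵥ* Z) 1 - (k h ᵥ* Z) 0) * (q h ᵥ* Z) c))) := by
  rw [rankOneLayer_eval, Matrix.sum_apply]
  refine Finset.sum_congr rfl fun h _ => ?_
  rw [mul_apply, Fin.sum_univ_two, softmax_two_apply_zero, softmax_two_apply_one]
  simp only [vecMulVec_apply, sub_mul]

end RankOneLayer

/-- The softmax-weighted mean of `x` and `ε`, a smooth approximation of `max x ε`. -/
noncomputable def smoothMax (lam ε x : ℝ) : ℝ :=
  x * sigmoid (lam * (x - ε)) + ε * sigmoid (lam * (ε - x))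

theorem smoothMax_comm (lam ε x : ℝ) : smoothMax lam ε x = smoothMax lam x ε :=
  add_comm _ _

theorem mul_sigmoid_neg_le_one (x : ℝ) : x * sigmoid (-x) ≤ 1 := by
  rw [sigmoid_def, neg_neg, ← div_eq_mul_inv, div_le_one (by positivity)]
  linarith [add_one_le_exp x]

theorem abs_smoothMax_sub_max_le {lam : ℝ} (hlam : 0 < lam) (ε x : ℝ) :
    |smoothMax lam ε x - max x ε| ≤ 1 / lam := by
  wlog hx : ε ≤ x generalizing ε x
  · rw [smoothMax_comm, max_comm]
    exact this x ε (le_of_not_ge hx)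
  have hgap : smoothMax lam ε x - max x ε = -((x - ε) * sigmoid (-(lam * (x - ε)))) := by
    rw [smoothMax, max_eq_left hx, ← neg_sub x ε, mul_neg, sigmoid_neg]
    ring
  rw [hgap, abs_neg, abs_of_nonneg (mul_nonneg (sub_nonneg.2 hx) (sigmoid_nonneg _)),
    le_div_iff₀ hlam]
  linarith [mul_sigmoid_neg_le_one (lam * (x - ε))]

/-- The layer that replaces the first coordinate `x` of both tokens by `smoothMax lam ε x`
(head `0`) while keeping their positional codes (head `1`); the other heads vanish. -/
noncomputable def smoothMaxLayer (lam ε : ℝ) (m : ℕ) : AttnLayer (m + 2) 3 3 :=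
  rankOneLayer (Fin.cons ![1, 0, ε] (Fin.cons ![0, log 3 / lam, 0] 0))
    (Fin.cons ![0, 1, 1] (Fin.cons ![0, 1, 0] 0))
    -- `[2, -2; -1, 3]` inverts the attention matrix `[3/4, 1/2; 1/4, 1/2]` of head `1`.
    (Fin.cons !![1, 0, ε; 0, 0, 0; 0, 0, 0] (Fin.cons !![0, 0, 0; 0, 2, -2; 0, -1, 3] 0))

/-- The layer that, on tokens with equal first coordinate `y`, adds up the sigmoids
`v i * sigmoid (-(b + t i * y))`, one per head. -/
noncomputable def sigmoidLayer {M : ℕ} (lam b : ℝ) (t v : Fin M → ℝ) : AttnLayer M 3 1 :=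
  rankOneLayer (fun _ => ![0, 1, 0]) (fun i => ![-(t i / lam), -(b / lam), -(b / lam)])
    fun i => !![0, v i, 0]

/-- The layer that multiplies sequences of equal scalar tokens by `a`. -/
def scalingLayer (a : ℝ) (m : ℕ) : AttnLayer (m + 1) 1 1 :=
  rankOneLayer 0 0 (Fin.cons !![a] 0)

theorem smoothMaxLayer_eval {lam : ℝ} (hlam : lam ≠ 0) (ε x : ℝ) (m : ℕ) :
    (smoothMaxLayer lam ε m).eval lam !![x, 0; 1, 0; 0, 1]
      = !![smoothMax lam ε x, smoothMax lam ε x; 1, 0; 0, 1] := by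
  have hlog : lam * (log 3 / lam) = log 3 := mul_div_cancel₀ _ hlam
  have hsigmoid : sigmoid (log 3) = 3 / 4 := by
    rw [sigmoid_def, exp_neg, exp_log three_pos]
    norm_num
  ext i c
  rw [smoothMaxLayer, rankOneLayer_eval_two_tokens_apply]
  fin_cases i <;> fin_cases c <;>
    simp [Fin.sum_univ_succ, vecMul, mul_apply, hlog, hsigmoid, smoothMax, sigmoid_neg] <;>
    norm_num

theorem sigmoidLayer_eval {M : ℕ} {lam : ℝ} (hlam : lam ≠ 0) (b y : ℝ) (t v : Fin M → ℝ) :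
    (sigmoidLayer lam b t v).eval lam !![y, y; 1, 0; 0, 1]
      = !![∑ i, v i * sigmoid (-(b + t i * y)), ∑ i, v i * sigmoid (-(b + t i * y))] := by
  have hscore (i) : lam * (-(t i / lam * y) + -(b / lam)) = -(b + t i * y) := by field
  ext i c
  rw [sigmoidLayer, rankOneLayer_eval_two_tokens_apply]
  fin_cases i
  fin_cases c <;> simp [vecMul, mul_apply, Fin.sum_univ_succ (n := 2), hscore, -neg_add_rev]

theorem scalingLayer_eval (lam a s : ℝ) (m : ℕ) :
    (scalingLayer a m).eval lam !![s, s] = !![a * s, a * s] := by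
  ext i c
  rw [scalingLayer, rankOneLayer_eval_two_tokens_apply]
  fin_cases i
  fin_cases c <;> simp [Fin.sum_univ_succ] <;> ring

theorem frobNorm_le_iff {m n : ℕ} {A : Matrix (Fin m) (Fin n) ℝ} {c : ℝ} (hc : 0 ≤ c) :
    frobNorm A ≤ c ↔ ∑ i, ∑ j, A i j ^ 2 ≤ c ^ 2 := by
  rw [frobNorm_eq_sqrt, sqrt_le_left hc]

theorem rankOneLayer_withinBudget {H din dout W : ℕ} {k q : Fin H → Fin din → ℝ}
    {V : Fin H → Matrix (Fin dout) (Fin din) ℝ} {CKQ CV : ℝ} (hW : 1 ≤ W) (hdin : din ≤ W)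
    (hdout : dout ≤ W) (hCKQ : 0 ≤ CKQ) (hCV : 0 ≤ CV)
    (hKQ : ∀ h, (∑ i, k h i ^ 2) * ∑ j, q h j ^ 2 ≤ CKQ ^ 2)
    (hV : ∀ h, ∑ i, ∑ j, V h i j ^ 2 ≤ CV ^ 2) :
    (rankOneLayer k q V).WithinBudget W CKQ CV := by
  refine ⟨hdin, hdout, fun h => ⟨hW, (frobNorm_le_iff hCKQ).2 ?_, (frobNorm_le_iff hCV).2 (hV h)⟩⟩
  simpa only [rankOneLayer_WKQ, vecMulVec_apply, mul_pow, Finset.sum_mul_sum] using hKQ h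

theorem smoothMaxLayer_withinBudget {lam ε CV : ℝ} (hε : |ε| ≤ 1) (hlam : |log 3 / lam| ≤ 2)
    (hCV : 5 ≤ CV) (m : ℕ) : (smoothMaxLayer lam ε m).WithinBudget 3 2 CV := by
  have hε2 : ε ^ 2 ≤ 1 := (sq_le_one_iff_abs_le_one ε).2 hε
  have hlam2 : (log 3 / lam) ^ 2 ≤ 2 ^ 2 := sq_le_sq' (abs_le.1 hlam).1 (abs_le.1 hlam).2
  have hCV2 : 5 ^ 2 ≤ CV ^ 2 := by gcongr
  refine rankOneLayer_withinBudget (by lia) le_rfl le_rfl zero_le_two (by linarith)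
    (Fin.cases ?_ (Fin.cases ?_ fun i => ?_)) (Fin.cases ?_ (Fin.cases ?_ fun i => ?_)) <;>
  simp [Fin.sum_univ_succ] <;> linarith

theorem sigmoidLayer_withinBudget {M : ℕ} {lam b CV : ℝ} {t v : Fin M → ℝ} (hCV : 0 ≤ CV)
    (hb : |b / lam| ≤ 1) (ht : ∀ i, |t i / lam| ≤ 1) (hv : ∀ i, |v i| ≤ CV) :
    (sigmoidLayer lam b t v).WithinBudget 3 2 CV := by
  have hb2 : (b / lam) ^ 2 ≤ 1 := (sq_le_one_iff_abs_le_one _).2 hb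
  have ht2 (i) : (t i / lam) ^ 2 ≤ 1 := (sq_le_one_iff_abs_le_one _).2 (ht i)
  refine rankOneLayer_withinBudget (by lia) le_rfl (by lia) zero_le_two hCV (fun i => ?_)
    fun i => ?_
  · simp [Fin.sum_univ_succ]
    linarith [ht2 i]
  · simpa [Fin.sum_univ_succ] using sq_le_sq' (abs_le.1 (hv i)).1 (abs_le.1 (hv i)).2

theorem scalingLayer_withinBudget {a CV : ℝ} (ha : |a| ≤ CV) (m : ℕ) :
    (scalingLayer a m).WithinBudget 3 2 CV := by
  refine rankOneLayer_withinBudget (by lia) (by lia) (by lia) zero_le_two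
    ((abs_nonneg a).trans ha) (by simp) (Fin.cases ?_ fun i => ?_)
  · simpa using sq_le_sq' (abs_le.1 ha).1 (abs_le.1 ha).2
  · simpa using sq_nonneg CV

theorem sigmoid_neg_le_exp_neg (x : ℝ) : sigmoid (-x) ≤ exp (-x) := by
  rw [← sigmoid_mul_rexp_neg]
  exact mul_le_of_le_one_left (exp_pos _).le (sigmoid_le_one x)

theorem abs_exp_mul_sigmoid_sub_exp_neg_le (b : ℝ) {u : ℝ} (hu : 0 ≤ u) :
    |exp b * sigmoid (-(b + u)) - exp (-u)| ≤ exp (-b) * exp (-u) := by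
  have hsplit : exp b * exp (-(b + u)) = exp (-u) := by
    rw [← exp_add]
    ring_nf
  have herror : exp b * sigmoid (-(b + u)) - exp (-u) = -(exp (-u) * sigmoid (-(b + u))) := by
    rw [← sigmoid_mul_rexp_neg, mul_left_comm, hsplit, sigmoid_mul_rexp_neg, sigmoid_neg]
    ring
  rw [herror, abs_neg, abs_of_nonneg (mul_nonneg (exp_pos _).le (sigmoid_nonneg _)), mul_comm]
  gcongr
  calc sigmoid (-(b + u)) ≤ exp (-(b + u)) := sigmoid_neg_le_exp_neg _
    _ ≤ exp (-b) := exp_le_exp.2 (by linarith)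

theorem abs_sum_sigmoid_sub_sum_exp_le {ι : Type*} [Fintype ι] {t w : ι → ℝ} (ht : ∀ i, 0 ≤ t i)
    (hw : ∀ i, 0 ≤ w i) (b : ℝ) {y : ℝ} (hy : 0 ≤ y) :
    |∑ i, w i * (exp b * sigmoid (-(b + t i * y))) - ∑ i, w i * exp (-(y * t i))|
      ≤ exp (-b) * ∑ i, w i * exp (-(y * t i)) := by
  rw [← Finset.sum_sub_distrib, Finset.mul_sum]
  refine (Finset.abs_sum_le_sum_abs _ _).trans (Finset.sum_le_sum fun i _ => ?_)
  rw [← mul_sub, abs_mul, abs_of_nonneg (hw i), mul_left_comm (exp (-b)), mul_comm y]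
  exact mul_le_mul_of_nonneg_left
    (abs_exp_mul_sigmoid_sub_exp_neg_le b (mul_nonneg (ht i) hy)) (hw i)

/-- The stack of four layers that sends `x` to the sum of `w i * (exp b * sigmoid (-(b + t i * y)))`
with `y = smoothMax lam ε x`. The two layers scaling by `a` let the weights of the sigmoids be
smaller by the factor `a ^ 2`, so that every value matrix is within the budget. -/
noncomputable def expSumStack (lam ε b a : ℝ) {m : ℕ} (t w : Fin (m + 2) → ℝ) :
    AttnStack (m + 2) 4 3 1 :=
  .cons (smoothMaxLayer lam ε m) <|
  .cons (sigmoidLayer lam b t fun i => w i * exp b / a ^ 2) <|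
  .cons (scalingLayer a (m + 1)) <|
  .cons (scalingLayer a (m + 1)) (.nil 1)

theorem expSumStack_eval {lam a : ℝ} (hlam : lam ≠ 0) (ha : a ≠ 0) (ε b x : ℝ) {m : ℕ}
    (t w : Fin (m + 2) → ℝ) :
    (expSumStack lam ε b a t w).eval lam (preprocess !![x]) 0 0
      = ∑ i, w i * (exp b * sigmoid (-(b + t i * smoothMax lam ε x))) := by
  rw [preprocess_one_one]
  simp only [expSumStack, AttnStack.eval]
  rw [smoothMaxLayer_eval hlam, sigmoidLayer_eval hlam, scalingLayer_eval, scalingLayer_eval]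
  simp only [of_apply, cons_val_zero, Finset.mul_sum]
  refine Finset.sum_congr rfl fun i _ => ?_
  field

theorem expSumStack_withinBudget {lam ε b a CV : ℝ} {m : ℕ} {t w : Fin (m + 2) → ℝ}
    (hε : |ε| ≤ 1) (hlam : |log 3 / lam| ≤ 2) (hb : |b / lam| ≤ 1) (ha : |a| ≤ CV)
    (ht : ∀ i, |t i / lam| ≤ 1) (hw : ∀ i, |w i * exp b / a ^ 2| ≤ CV) (hCV : 5 ≤ CV) :
    (expSumStack lam ε b a t w).WithinBudget 3 2 CV :=
  ⟨smoothMaxLayer_withinBudget hε hlam hCV m,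
    sigmoidLayer_withinBudget (by linarith) hb ht hw,
    scalingLayer_withinBudget ha _, scalingLayer_withinBudget ha _, trivial⟩

theorem expSumStack_withinBudget_of_le {δ : ℝ} (hδ : 1 ≤ δ) {m : ℕ} {t w : Fin (m + 2) → ℝ}
    (ht : ∀ i, 0 ≤ t i ∧ t i ≤ 1000 * δ ^ 3) (hw : ∀ i, 0 ≤ w i ∧ w i ≤ 1000 * δ ^ 3) :
    (expSumStack (1000 * δ ^ 3) (1 / δ) (log (16 * δ ^ 2)) (δ ^ 2) t w).WithinBudget
      3 2 (16000 * δ ^ 2) := by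
  have hδ0 : 0 < δ := one_pos.trans_le hδ
  have hδ2 : 1 ≤ δ ^ 2 := one_le_pow₀ hδ
  have hδ23 : δ ^ 2 ≤ δ ^ 3 := pow_le_pow_right₀ hδ (by lia)
  have hlam : 0 < 1000 * δ ^ 3 := by positivity
  refine expSumStack_withinBudget ?_ ?_ ?_ ?_ (fun i => ?_) (fun i => ?_) (by linarith)
  · rwa [abs_of_pos (by positivity), div_le_one hδ0]
  · rw [abs_of_nonneg (by positivity), div_le_iff₀ hlam]
    linarith [log_le_sub_one_of_pos (show (0 : ℝ) < 3 by norm_num)]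
  · rw [abs_of_nonneg (div_nonneg (log_nonneg (by linarith)) hlam.le), div_le_one hlam]
    linarith [log_le_sub_one_of_pos (show 0 < 16 * δ ^ 2 by positivity)]
  · rw [abs_of_pos (by positivity)]
    linarith
  · rw [abs_of_nonneg (div_nonneg (ht i).1 hlam.le), div_le_one hlam]
    exact (ht i).2
  · have := (hw i).1
    rw [exp_log (by positivity), abs_of_nonneg (by positivity), div_le_iff₀ (by positivity)]
    calc w i * (16 * δ ^ 2) ≤ 1000 * δ ^ 3 * (16 * δ ^ 2) := by gcongr; exact (hw i).2
      _ = 16000 * δ ^ 5 := by ring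
      _ ≤ 16000 * δ ^ 6 := by gcongr; lia
      _ = 16000 * δ ^ 2 * (δ ^ 2) ^ 2 := by ring

theorem abs_sum_sigmoid_sub_inv_le {δ : ℝ} (hδ : 1 ≤ δ) {ι : Type*} [Fintype ι] {t w : ι → ℝ}
    (ht : ∀ i, 0 ≤ t i) (hw : ∀ i, 0 ≤ w i) {y : ℝ} (hy : 1 / (2 * δ) ≤ y)
    (happrox : |∑ i, w i * exp (-(y * t i)) - 1 / y| ≤ 1 / (4 * δ)) :
    |∑ i, w i * (exp (log (16 * δ ^ 2)) * sigmoid (-(log (16 * δ ^ 2) + t i * y))) - 1 / y|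
      ≤ 1 / (2 * δ) := by
  have hδ0 : 0 < δ := one_pos.trans_le hδ
  have hy0 : 0 < y := (one_div_pos.2 (mul_pos two_pos hδ0)).trans_le hy
  have hyinv : 1 / y ≤ 2 * δ := (div_le_comm₀ hy0 (by positivity)).2 hy
  have hsum : ∑ i, w i * exp (-(y * t i)) ≤ 4 * δ := by
    have : 1 / (4 * δ) ≤ 1 := (div_le_one (by positivity)).2 (by linarith)
    linarith [(abs_le.1 happrox).2]
  have hsigmoid := abs_sum_sigmoid_sub_sum_exp_le ht hw (log (16 * δ ^ 2)) hy0.le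
  have herror : exp (-log (16 * δ ^ 2)) * ∑ i, w i * exp (-(y * t i)) ≤ 1 / (4 * δ) := by
    rw [exp_neg, exp_log (by positivity)]
    calc _ ≤ (16 * δ ^ 2)⁻¹ * (4 * δ) := by gcongr
      _ = 1 / (4 * δ) := by field
  calc _ ≤ _ := abs_sub_le _ (∑ i, w i * exp (-(y * t i))) _
    _ ≤ 1 / (4 * δ) + 1 / (4 * δ) := add_le_add (hsigmoid.trans herror) happrox
    _ = 1 / (2 * δ) := by field

theorem le_smoothMax {δ lam : ℝ} (hδ : 1 ≤ δ) (hlam : 8 * δ ^ 3 ≤ lam) (x : ℝ) :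
    1 / (2 * δ) ≤ smoothMax lam (1 / δ) x := by
  have hδ0 : 0 < δ := one_pos.trans_le hδ
  have hlam0 : 0 < lam := lt_of_lt_of_le (by positivity) hlam
  have hlam2 : 1 / lam ≤ 1 / (2 * δ) := by
    gcongr
    nlinarith [mul_le_mul_of_nonneg_left (one_le_pow₀ hδ : 1 ≤ δ ^ 2) hδ0.le]
  have hhalf : 1 / δ = 1 / (2 * δ) + 1 / (2 * δ) := by field
  linarith [(abs_le.1 (abs_smoothMax_sub_max_le hlam0 (1 / δ) x)).1, le_max_right x (1 / δ)]

theorem abs_inv_smoothMax_sub_inv_max_le {δ lam : ℝ} (hδ : 1 ≤ δ) (hlam : 8 * δ ^ 3 ≤ lam)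
    (x : ℝ) : |1 / smoothMax lam (1 / δ) x - 1 / max x (1 / δ)| ≤ 1 / (2 * δ) := by
  have hδ0 : 0 < δ := one_pos.trans_le hδ
  have hlam0 : 0 < lam := lt_of_lt_of_le (by positivity) hlam
  have hmax : 1 / (2 * δ) ≤ max x (1 / δ) :=
    le_max_of_le_right (one_div_le_one_div_of_le hδ0 (by linarith))
  calc _ ≤ _ := abs_one_div_sub_one_div_le (by positivity) hmax (le_smoothMax hδ hlam x)
    _ ≤ 1 / (8 * δ ^ 3) / (1 / (2 * δ)) ^ 2 := by
      gcongr
      exact (abs_smoothMax_sub_max_le hlam0 _ x).trans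
        (one_div_le_one_div_of_le (by positivity) hlam)
    _ = 1 / (2 * δ) := by field

theorem exists_transformer_approx_inv_max {δ : ℝ} (hδ : 1 ≤ δ) :
    ∃ H : ℕ, ∃ f ∈ Transformer 1 1 1 H 3 4 2 (16000 * δ ^ 2) (1000 * δ ^ 3),
      (H : ℝ) ≤ 16 * (1 + log δ) ^ 2 ∧ ∀ x, |f !![x] 0 0 - 1 / max x (1 / δ)| ≤ 1 / δ := by
  have hδ0 : 0 < δ := one_pos.trans_le hδ
  have hlam : 8 * δ ^ 3 ≤ 1000 * δ ^ 3 := by gcongr; norm_num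
  obtain ⟨M, t, w, hM, hMlog, ht, hw, happrox⟩ := exists_expSum_approx_inv hδ
  obtain ⟨m, rfl⟩ := Nat.exists_eq_add_of_le' hM
  let stack := expSumStack (1000 * δ ^ 3) (1 / δ) (log (16 * δ ^ 2)) (δ ^ 2) t w
  refine ⟨m + 2, fun X => truncate (stack.eval (1000 * δ ^ 3) (preprocess X)),
    ⟨by lia, by lia, by lia, by norm_num, by positivity, by positivity, stack,
      expSumStack_withinBudget_of_le hδ ht hw, fun _ => rfl⟩, hMlog, fun x => ?_⟩
  have heval : truncate (stack.eval (1000 * δ ^ 3) (preprocess !![x])) 0 0 = _ :=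
    expSumStack_eval (by positivity) (pow_pos hδ0 2).ne' ..
  beta_reduce
  rw [heval]
  calc _ ≤ _ := abs_sub_le _ (1 / smoothMax (1000 * δ ^ 3) (1 / δ) x) _
    _ ≤ 1 / (2 * δ) + 1 / (2 * δ) :=
      add_le_add
        (abs_sum_sigmoid_sub_inv_le hδ (fun i => (ht i).1) (fun i => (hw i).1)
          (le_smoothMax hδ hlam x) (happrox _ (le_smoothMax hδ hlam x)))
        (abs_inv_smoothMax_sub_inv_max_le hδ hlam x)
    _ = 1 / δ := by field

end SoftmaxAttention

theorem mainTheorem5_general {ε : ℝ} (hε : 0 < ε) (hε1 : ε ≤ 1) :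
    ∃ H : ℕ, ∃ f ∈ SoftmaxAttention.Transformer 1 1 1 H 3 4 2
        (16000 * (1 / ε) ^ 2) (1000 * (1 / ε) ^ 3),
      (H : ℝ) ≤ 16 * (1 + Real.log (1 / ε)) ^ 2 ∧
      ∀ x, ε ≤ x → ∀ x', |f !![x'] 0 0 - 1 / x| ≤ ε + |x' - x| / ε ^ 2 := by
  obtain ⟨H, f, hf, hH, happrox⟩ :=
    SoftmaxAttention.exists_transformer_approx_inv_max ((one_le_div hε).2 hε1)
  rw [one_div_one_div] at happrox
  refine ⟨H, f, hf, hH, fun x hx x' => ?_⟩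
  calc _ ≤ _ := abs_sub_le _ (1 / max x' ε) _
    _ ≤ ε + |max x' ε - max x ε| / ε ^ 2 := by
      rw [max_eq_left hx]
      exact add_le_add (happrox x') (abs_one_div_sub_one_div_le hε hx (le_max_right _ _))
    _ ≤ ε + |x' - x| / ε ^ 2 := by
      gcongr ε + ?_ / _
      exact abs_max_sub_max_le_abs x' x ε

theorem transformer_budget_le_polylog {ε CX : ℝ} (hε : 0 < ε) (hε1 : ε ≤ 1) (hCX : 1 ≤ CX)
    {H : ℕ} (hH : (H : ℝ) ≤ 16 * (1 + Real.log (1 / ε)) ^ 2) :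
    (H : ℝ) ≤ 16000 * (1 + Real.log (1 / ε)) ^ 3 ∧
    ((3 : ℕ) : ℝ) ≤ 16000 * (1 + Real.log (1 / ε)) ^ 3 ∧
    ((4 : ℕ) : ℝ) ≤ 16000 * (1 + Real.log (1 / ε)) ^ 2 ∧
    16000 * (1 / ε) ^ 2 ≤ 16000 * ((1 / ε) ^ 2 * √((1 + Real.log (1 / ε)) ^ 3)) ∧
    2 ≤ 16000 * √((1 + Real.log (1 / ε)) ^ 2 * (1 + Real.log (CX / ε))) ∧
    1000 * (1 / ε) ^ 3 ≤ 16000 * ((1 / ε) ^ ((Polynomial.C 3).eval (Real.log (1 / ε))) *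
      (1 + Real.log (1 / ε)) ^ ((0 : Polynomial ℝ).eval (Real.log (1 / ε))) *
      (1 + Real.log CX)) := by
  have hlogCX : 0 ≤ Real.log CX := Real.log_nonneg hCX
  have hlogδCX : 1 ≤ 1 + Real.log (CX / ε) :=
    le_add_of_nonneg_right (Real.log_nonneg ((one_le_div hε).2 (hε1.trans hCX)))
  have hlog : 1 ≤ 1 + Real.log (1 / ε) :=
    le_add_of_nonneg_right (Real.log_nonneg ((one_le_div hε).2 hε1))
  generalize Real.log (1 / ε) = l at *
  have hlog2 : 1 ≤ (1 + l) ^ 2 := one_le_pow₀ hlog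
  have hlog3 : 1 ≤ (1 + l) ^ 3 := one_le_pow₀ hlog
  have hlog23 : (1 + l) ^ 2 ≤ (1 + l) ^ 3 := pow_le_pow_right₀ hlog (by lia)
  refine ⟨by linarith, by push_cast; linarith, by push_cast; linarith, ?_, ?_, ?_⟩
  · gcongr
    exact le_mul_of_one_le_right (by positivity) (Real.one_le_sqrt.2 hlog3)
  · linarith [Real.one_le_sqrt.2 (one_le_mul_of_one_le_of_one_le hlog2 hlogδCX)]
  · rw [Polynomial.eval_C, Polynomial.eval_zero, Real.rpow_zero, mul_one, Real.rpow_ofNat]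
    gcongr
    · norm_num
    · exact le_mul_of_one_le_right (by positivity) (by linarith)

theorem mainTheorem5 :
    ∃ (C : ℝ) (p q : Polynomial ℝ), 0 < C ∧
      ∀ ε : ℝ, 0 < ε → ε < 1 → ∀ CX : ℝ, 0 < CX →
        ∃ (H W K : ℕ) (CKQ CV lam : ℝ),
          ∃ f ∈ SoftmaxAttention.Transformer 1 1 1 H W K CKQ CV lam,
            (∀ x ∈ Set.Icc ε (1 / ε), ∀ x' ∈ Set.Icc (-CX) CX,
              |f !![x'] 0 0 - 1 / x| ≤ 2 * ε + |x' - x| / ε ^ 2) ∧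
            (1 ≤ CX →
              (H : ℝ) ≤ C * (1 + Real.log (1 / ε)) ^ 3 ∧
              (W : ℝ) ≤ C * (1 + Real.log (1 / ε)) ^ 3 ∧
              (K : ℝ) ≤ C * (1 + Real.log (1 / ε)) ^ 2 ∧
              CV ≤ C * ((1 / ε) ^ 2 * Real.sqrt ((1 + Real.log (1 / ε)) ^ 3)) ∧
              CKQ ≤ C * Real.sqrt ((1 + Real.log (1 / ε)) ^ 2 * (1 + Real.log (CX / ε))) ∧
              lam ≤ C * ((1 / ε) ^ (p.eval (Real.log (1 / ε))) *
                (1 + Real.log (1 / ε)) ^ (q.eval (Real.log (1 / ε))) *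
                (1 + Real.log CX))) := by
  refine ⟨16000, Polynomial.C 3, 0, by norm_num, fun ε hε hε1 CX _ => ?_⟩
  obtain ⟨H, f, hf, hH, happrox⟩ := mainTheorem5_general hε hε1.le
  exact ⟨H, 3, 4, 2, _, _, f, hf, fun x hx x' _ => (happrox x hx.1 x').trans (by linarith),
    fun hCX => transformer_budget_le_polylog hε hε1.le hCX hH⟩
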